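/- Let $J$ be the Jacobi operator on $\ell^2(\mathbb N)$, $\mathbb N=\{1,2,3,\dots\}$, with diagonal entries $b_k=2$ and off-diagonal entries $a_1=-\sqrt2$, $a_k=-1$ for $k\ge 2$; put also $a_0=-\sqrt2$. Let $n\ge 1$, let $V=\mathrm{diag}[v_1,v_2,\dots]$ with $v_k\in\mathbb R$, let $P_n$ be the orthogonal projection onto the span of the first $n$ standard basis vectors, and let $J_n=J+P_nVP_n$. For a self-adjoint operator $A$ let $E_A$ be its spectral measure. Call $J_n$ critical at the left threshold $0$ (respectively, at the right threshold $4$) if the function $$W\mapsto \mathrm{tr}\,E_{J+W}((-\infty,0))\qquad (\text{resp. } W\mapsto \mathrm{tr}\,E_{J+W}((4,\infty))),$$ considered on the set of real diagonal potentials $W=\mathrm{diag}[w_1,\dots,w_n,0,0,\dots]$ supported on $[1,\dots,n]$ with the operator norm, is discontinuous at $W=P_nVP_n$. For $0<|\Theta|<1$ and $z=2-\Theta-\Theta^{-1}$ let $\{j^{(n)}_k(\Theta)\}_{k\ge0}$ be the Jost solution of $J_n$, that is, the solution of $$a_{k-1}j_{k-1}+(b_k+v_k\mathbf 1_{k\le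 n})j_k+a_kj_{k+1}=zj_k,\quad k\ge1,\qquad \lim_{k\to\infty}\Theta^{-k}j_k=1.$$ Each $j_k^{(n)}$ is a polynomial in $\Theta$, and is continued to all $\Theta\in\mathbb C$ as such. The function $j_0^{(n)}$ is the Jost function, and $C_n=j_0^{(n)}(1)$. A virtual state at $\lambda$ is a bounded sequence $\Psi=\{\Psi_k\}_{k\ge1}$, not in $\ell^2(\mathbb N)$, with $J_n\Psi=\lambda\Psi$ (where $J_n$ acts as a tridiagonal matrix); $\lambda$ is a virtual level of $J_n$ if such a $\Psi$ exists. Then $J_n$ is critical at the left (resp. right) threshold if and only if $$C_n=j_0^{(n)}(1)=0\qquad(\text{resp. } j_0^{(n)}(-1)=0).$$ In this case the left threshold $0$ (resp. the right threshold $4$) is a virtual level of $J_n$, and the Jost solution $\Psi^{(\ell)}=\{j_k^{(n)}(1)\}_{k\ge1}$ (resp. $\Psi^{(r)}=\{j_k^{(n)}(-1)\}_{k\ge1}$) is a virtual state: it is bounded, not in $\ell^2(\mathbb N)$, and $$J_n\Psi^{(\ell)}=0\qquad(\text{resp. } J_n\Psi^{(r)}=4\Psi^{(r)}).$$ Moreover,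 $$\Psi^{(\ell)}_k=1\quad(\text{resp. } \Psi^{(r)}_k=(-1)^k),\qquad k\ge\max\{2,n\}.$$ -/

import Mathlib

open Filter Topology Polynomial
open scoped ENNReal ComplexConjugate

noncomputable section

namespace HalfLine

/-! The lattice is `{1, 2, 3, …}`. In `ℓ²` and in potentials the coordinate with index `i : ℕ` is the
one of the lattice site `i + 1`; thus `v i` stands for `v_{i+1}`. Solutions of the difference
equation are indexed by `0, 1, 2, …` without any shift. -/

/-- The Hilbert space `ℓ²` of the lattice `{1, 2, 3, …}`. -/
abbrev H : Type := lp (fun _ : ℕ => ℂ) 2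

/-- The standard basis vector at the lattice site `i + 1`. -/
def e (i : ℕ) : H := lp.single 2 i 1

/-- The off-diagonal entries `a_0 = a_1 = -√2`, `a_k = -1` for `k ≥ 2`. Here `a_0` is not an entry
of the matrix; it only normalizes the zeroth component of solutions. -/
def a : ℕ → ℝ
  | 0 => -√2
  | 1 => -√2
  | _ + 2 => -1

/-- The diagonal of `P_n V P_n`, where `V = diag (v 0, v 1, …)`. -/
def pot (n : ℕ) (v : ℕ → ℝ) (i : ℕ) : ℝ := if i < n then v i else 0

/-- The tridiagonal matrix `J + P_n V P_n` applied to a column `ψ` (not necessarily in `ℓ²`). -/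
def matrixAct (n : ℕ) (v : ℕ → ℝ) (ψ : ℕ → ℂ) : ℕ → ℂ
  | 0 => (2 + pot n v 0) * ψ 0 + a 1 * ψ 1
  | i + 1 => a (i + 1) * ψ i + (2 + pot n v (i + 1)) * ψ (i + 1) + a (i + 2) * ψ (i + 2)

/-! ### The operators -/

theorem shift_summable (f : H) :
    Summable fun i : ℕ => ‖(Nat.casesOn i 0 f : ℂ)‖ ^ (2 : ℝ) := by
  have hf := (memℓp_gen_iff (p := 2) (by norm_num)).1 (lp.memℓp f)
  refine (summable_nat_add_iff 1).1 ?_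
  simpa using hf

/-- The unilateral shift `δ_k ↦ δ_{k+1}`. -/
def shift : H →L[ℂ] H :=
  LinearMap.mkContinuous
    { toFun := fun f => ⟨fun i => Nat.casesOn i 0 f,
        (memℓp_gen_iff (by norm_num)).2 (by simpa using shift_summable f)⟩
      map_add' := by
        intro f g
        ext i
        change _ = (Nat.casesOn i 0 f : ℂ) + (Nat.casesOn i 0 g : ℂ)
        cases i <;> simp
      map_smul' := by
        intro c f
        ext i
        cases i <;> simp }
    1 (by
      intro f
      rw [one_mul]
      have h2 : (0 : ℝ) < (2 : ℝ≥0∞).toReal := by norm_num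
      have hs := shift_summable f
      refine le_of_eq ?_
      refine (Real.rpow_left_inj (norm_nonneg _) (norm_nonneg _) h2.ne').1 ?_
      rw [lp.norm_rpow_eq_tsum h2, lp.norm_rpow_eq_tsum h2]
      simp only [ENNReal.toReal_ofNat]
      refine (hs.tsum_eq_zero_add).trans ?_
      simp)

/-- The free Jacobi operator `J` on `ℓ²`: diagonal entries `2`, off-diagonal entries `-√2` between
the sites `1` and `2` and `-1` elsewhere (see `add_apply` for its matrix). -/
def J : H →L[ℂ] H :=
  (2 : ℂ) • 1 - shift - ContinuousLinearMap.adjoint shift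
    - ((√2 - 1 : ℝ) : ℂ) •
      (InnerProductSpace.rankOne ℂ (e 0) (e 1) + InnerProductSpace.rankOne ℂ (e 1) (e 0))

/-- The operator `P_n V P_n = diag (v 0, …, v (n - 1), 0, 0, …)` on `ℓ²`. -/
def diagOp (n : ℕ) (v : ℕ → ℝ) : H →L[ℂ] H :=
  ∑ i ∈ Finset.range n, (v i : ℂ) • InnerProductSpace.rankOne ℂ (e i) (e i)

theorem inner_e (i : ℕ) (f : H) : inner ℂ (e i) f = f i := by
  simp [e, lp.inner_single_left]

theorem adjoint_shift_apply (f : H) (i : ℕ) :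
    (ContinuousLinearMap.adjoint shift f : H) i = f (i + 1) := by
  rw [← inner_e, ContinuousLinearMap.adjoint_inner_right, ← inner_e (i + 1)]
  congr 1
  ext j
  cases j with
  | zero => simp [shift, e, lp.single_apply, Pi.single_apply]
  | succ j => simp [shift, e, lp.single_apply, Pi.single_apply]

theorem diagOp_apply (n : ℕ) (v : ℕ → ℝ) (f : H) (i : ℕ) :
    (diagOp n v f : H) i = pot n v i * f i := by
  rw [← inner_e, diagOp]
  simp only [_root_.sum_apply, inner_sum, _root_.smul_apply,
    InnerProductSpace.rankOne_apply, inner_smul_right, inner_e]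
  simp only [e, lp.single_apply, Pi.single_apply, pot]
  split_ifs <;> simp_all

/-- `J + P_n V P_n` is given by the expected tridiagonal matrix. -/
theorem add_apply (n : ℕ) (v : ℕ → ℝ) (f : H) (i : ℕ) :
    ((J + diagOp n v) f : H) i = matrixAct n v f i := by
  have hd := diagOp_apply n v f i
  have hs := adjoint_shift_apply f i
  simp only [_root_.add_apply, lp.coeFn_add, Pi.add_apply, hd]
  simp only [J, _root_.sub_apply, lp.coeFn_sub, Pi.sub_apply, hs,
    _root_.smul_apply, lp.coeFn_smul, Pi.smul_apply, _root_.add_apply,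
    lp.coeFn_add, Pi.add_apply, InnerProductSpace.rankOne_apply, inner_e]
  rcases i with _ | _ | i
  · simp [shift, e, lp.single_apply, matrixAct, a]
    ring
  · simp [shift, e, lp.single_apply, matrixAct, a]
    ring
  · simp [shift, e, lp.single_apply, matrixAct, a]
    ring

theorem isSelfAdjoint_add (n : ℕ) (v : ℕ → ℝ) : IsSelfAdjoint (J + diagOp n v) := by
  have h (x y : H) : star (InnerProductSpace.rankOne ℂ x y) = InnerProductSpace.rankOne ℂ y x := by
    rw [ContinuousLinearMap.star_eq_adjoint, InnerProductSpace.adjoint_rankOne]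
  rw [IsSelfAdjoint, J, diagOp, ← ContinuousLinearMap.star_eq_adjoint]
  simp only [star_add, star_sub, star_smul, star_sum, h, star_star, star_one]
  simp only [RCLike.star_def, Complex.conj_ofReal, Complex.conj_ofNat]
  rw [add_comm (InnerProductSpace.rankOne ℂ (e 1) (e 0))]
  abel

/-! ### Spectral projections and criticality -/

/-- The spectral subspace of the self-adjoint operator `A` for the open set `U`: the closed span of
the ranges of all `f(A)` with `f` continuous and zero outside `U`. -/
def spectralSubspace {E : Type*} [NormedAddCommGroup E] [InnerProductSpace ℂ E] [CompleteSpace E]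
    (A : E →L[ℂ] E) (U : Set ℝ) : Submodule ℂ E :=
  (⨆ f ∈ {f : ℝ → ℝ | Continuous f ∧ ∀ x, x ∉ U → f x = 0},
    LinearMap.range (cfc f A : E →L[ℂ] E).toLinearMap).topologicalClosure

instance {E : Type*} [NormedAddCommGroup E] [InnerProductSpace ℂ E] [CompleteSpace E]
    (A : E →L[ℂ] E) (U : Set ℝ) : CompleteSpace (spectralSubspace A U) :=
  inferInstanceAs (CompleteSpace (Submodule.topologicalClosure _))

/-- The value `E_A(U)` of the spectral measure of the self-adjoint operator `A` on the open set
`U`. -/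
def spectralProj {E : Type*} [NormedAddCommGroup E] [InnerProductSpace ℂ E] [CompleteSpace E]
    (A : E →L[ℂ] E) (U : Set ℝ) : E →L[ℂ] E :=
  (spectralSubspace A U).starProjection

/-- The trace of a nonnegative operator, possibly `∞`. -/
def trace (T : H →L[ℂ] H) : ℝ≥0∞ :=
  ∑' i, ENNReal.ofReal (inner ℂ (e i) (T (e i))).re

/-- `tr E_{J+V}((-∞, 0))`, the number of eigenvalues of `J + V` below `0` with multiplicity. -/
def countBelow (V : H →L[ℂ] H) : ℝ≥0∞ := trace (spectralProj (J + V) (Set.Iio 0))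

/-- `tr E_{J+V}((4, ∞))`, the number of eigenvalues of `J + V` above `4` with multiplicity. -/
def countAbove (V : H →L[ℂ] H) : ℝ≥0∞ := trace (spectralProj (J + V) (Set.Ioi 4))

/-- The real diagonal potentials supported on the first `n` lattice sites, with the topology
of the operator norm. -/
def potentials (n : ℕ) : Set (H →L[ℂ] H) := Set.range (diagOp n)

/-- `J + P_n V P_n` is critical at the left threshold `0`. -/
def IsCriticalLeft (n : ℕ) (v : ℕ → ℝ) : Prop :=
  ¬ ContinuousWithinAt countBelow (potentials n) (diagOp n v)

/-- `J + P_n V P_n` is critical at the right threshold `4`. -/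
def IsCriticalRight (n : ℕ) (v : ℕ → ℝ) : Prop :=
  ¬ ContinuousWithinAt countAbove (potentials n) (diagOp n v)

/-! ### Jost solutions -/

/-- The Jost solution of `J + P_n V P_n` at the spectral parameter `z = 2 - Θ - 1/Θ`: a solution of
`a_{k-1} j_{k-1} + b_k j_k + a_k j_{k+1} = z j_k`, `k ≥ 1`, with `Θ^{-k} j_k → 1`. The equation is
written with `k = i + 1`. -/
def IsJostSolution (n : ℕ) (v : ℕ → ℝ) (Θ : ℂ) (j : ℕ → ℂ) : Prop :=
  (∀ i, a i * j i + (2 + pot n v i) * j (i + 1) + a (i + 1) * j (i + 2)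
      = (2 - Θ - Θ⁻¹) * j (i + 1)) ∧
    Tendsto (fun k => (Θ ^ k)⁻¹ * j k) atTop (𝓝 1)

/-- Polynomials in `Θ` that form the Jost solution for all `0 < |Θ| < 1`, that is, for all
`z = 2 - Θ - 1/Θ` in `ℂ \ [0, 4]`. -/
def IsJostFamily (n : ℕ) (v : ℕ → ℝ) (j : ℕ → ℂ[X]) : Prop :=
  ∀ Θ : ℂ, Θ ≠ 0 → ‖Θ‖ < 1 → IsJostSolution n v Θ fun k => (j k).eval Θ

/-- Auxiliary polynomials: `Θ ^ k * jostAux n v k` is the Jost solution. -/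
def jostAux (n : ℕ) (v : ℕ → ℝ) (k : ℕ) : ℂ[X] :=
  if max 2 n ≤ k then 1 else
    C (-(a k : ℂ)⁻¹) * ((1 + C (pot n v k : ℂ) * X + X ^ 2) * jostAux n v (k + 1)
      + C (a (k + 1) : ℂ) * X ^ 2 * jostAux n v (k + 2))
termination_by max 2 n - k

theorem a_ne_zero (k : ℕ) : a k ≠ 0 := by
  rcases k with _ | _ | k <;> simp [a]

theorem exists_isJostFamily (n : ℕ) (v : ℕ → ℝ) : ∃ j, IsJostFamily n v j := by
  refine ⟨fun k => X ^ k * jostAux n v k, fun Θ h0 _ => ⟨fun i => ?_, ?_⟩⟩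
  · have ha : (a i : ℂ) ≠ 0 := by exact_mod_cast a_ne_zero i
    by_cases hi : max 2 n ≤ i
    · beta_reduce
      have h1 : jostAux n v i = 1 := by rw [jostAux, if_pos hi]
      have h2 : jostAux n v (i + 1) = 1 := by rw [jostAux, if_pos (by omega)]
      have h3 : jostAux n v (i + 2) = 1 := by rw [jostAux, if_pos (by omega)]
      obtain ⟨m, rfl⟩ : ∃ m, i = m + 2 := ⟨i - 2, by omega⟩
      have hp : pot n v (m + 2) = 0 := if_neg (by omega)
      rw [h1, h2, h3, hp]
      simp [a]
      field_simp
      ring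
    · have hr := jostAux.eq_1 n v i
      rw [if_neg hi] at hr
      beta_reduce
      rw [hr]
      simp only [eval_mul, eval_add, eval_pow, eval_X, eval_C, eval_one]
      field_simp
      ring
  · refine tendsto_const_nhds.congr' ?_
    filter_upwards [eventually_ge_atTop (max 2 n)] with k hk
    have h1 : jostAux n v k = 1 := by rw [jostAux, if_pos hk]
    simp [h1, h0]

/-- The Jost solution `j_k(Θ)` of `J + P_n V P_n`, continued from `0 < |Θ| < 1` to all `Θ ∈ ℂ` as a
polynomial in `Θ`. (The Jost solution at a given `Θ` with `0 < |Θ| < 1` is unique, so there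
is only one such family.) -/
def jost (n : ℕ) (v : ℕ → ℝ) (Θ : ℂ) (k : ℕ) : ℂ :=
  ((exists_isJostFamily n v).choose k).eval Θ

/-- The Jost function `j_0(Θ)`; the threshold Jost function `C_n` is its value at `Θ = 1`. -/
def jostFunction (n : ℕ) (v : ℕ → ℝ) (Θ : ℂ) : ℂ := jost n v Θ 0

/-! ### Virtual states -/

/-- `ψ` is a virtual state of `J + P_n V P_n` at `lam`: a bounded solution of
`(J + P_n V P_n) ψ = lam ψ` that is not in `ℓ²`. -/
def IsVirtualState (n : ℕ) (v : ℕ → ℝ) (lam : ℝ) (ψ : ℕ → ℂ) : Prop :=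
  (∀ i, matrixAct n v ψ i = lam * ψ i) ∧ (∃ M : ℝ, ∀ i, ‖ψ i‖ ≤ M) ∧
    ¬ Memℓp ψ 2

/-- `lam` is a virtual level of `J + P_n V P_n`. -/
def IsVirtualLevel (n : ℕ) (v : ℕ → ℝ) (lam : ℝ) : Prop := ∃ ψ, IsVirtualState n v lam ψ

end HalfLine

end

/-!
The number of eigenvalues of `J + P_n V P_n` below `0` is the number of negative eigenvalues of a
finite Hermitian matrix, the threshold matrix, whose kernel is controlled by the Jost function.

Write `N + 2 = max 2 n`. The form of `J + P_n V P_n` is a sum of squares of first differences plus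
`∑ v_k |ψ_k|²` (`sum_conj_mul_matrixAct`), and beyond the site `N + 2` only squares of differences
remain. Given the first `N + 2` entries, the infimum over all continuations in `ℓ²` is the value of
the form on the continuation by the last entry, which is approached by slowly decaying sequences
(`inner_slowExtend_le`). Hence the eigenvalue count is the negative index of the form of the
threshold matrix (`IsNegativeSplit.isNegIndex`, `exists_countBelow_eq`). The only input
about spectral projections is that the form of `g(A)` is nonpositive on the spectral subspace of `A`
for `{g < 0}`, where it vanishes only on the kernel of `g(A)`, and nonnegative on the orthogonal
complement (`isNegativeSplit_spectralSubspace`).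

A null vector of the threshold matrix, continued by its last entry, is a multiple of the zero-energy
Jost solution, and the first row of the matrix then says that `j_0(1) = 0`
(`thresholdMatrix_injective_iff`). If the matrix is invertible, its index is stable under small
perturbations, and the count is locally constant (`not_isCriticalLeft`). If it has a null
vector, whose first entry cannot vanish, then the potentials `v - ε` have at least one more negative
eigenvalue than `v` for every `ε > 0`, and the count jumps (`isCriticalLeft_of_not_injective`).

The right threshold is reduced to the left one: conjugation by `(-1)^k` turns `4 - (J + V)`
into `J - V` (`countAbove_eq`), and `j_0(-1)` for `v` is `j_0(1)` for `-v` (`jostFunction_neg_one`).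
-/

namespace HalfLine

/-! ### Negative spectral subspaces -/

/-- The subspace `K` splits the quadratic form of `B` as a spectral subspace for `(-∞, 0)` does: the
form is nonpositive on `K`, where it vanishes only on the kernel of `B`, and it is nonnegative on
the orthogonal complement of `K`. -/
structure IsNegativeSplit {E : Type*} [NormedAddCommGroup E] [InnerProductSpace ℂ E]
    (B : E →L[ℂ] E) (K : Submodule ℂ E) : Prop where
  nonpos : ∀ f ∈ K, (inner ℂ f (B f)).re ≤ 0
  apply_eq_zero : ∀ f ∈ K, (inner ℂ f (B f)).re = 0 → B f = 0
  nonneg : ∀ f ∈ Kᗮ, 0 ≤ (inner ℂ f (B f)).re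

theorem IsNegativeSplit.map {E : Type*} [NormedAddCommGroup E] [InnerProductSpace ℂ E]
    {B B' : E →L[ℂ] E} {K : Submodule ℂ E} (h : IsNegativeSplit B K) (U : E ≃ₗᵢ[ℂ] E)
    (hU : ∀ f, B' (U f) = U (B f)) : IsNegativeSplit B' (K.map U.toLinearEquiv.toLinearMap) where
  nonpos := by
    rintro _ ⟨f, hf, rfl⟩
    simpa [hU] using h.nonpos f hf
  apply_eq_zero := by
    rintro _ ⟨f, hf, rfl⟩ h0
    have h0' : (inner ℂ f (B f)).re = 0 := by simpa [hU] using h0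
    simpa [hU] using h.apply_eq_zero f hf h0'
  nonneg := by
    intro g hg
    obtain ⟨f, rfl⟩ := U.surjective g
    have hf : f ∈ Kᗮ := by
      rw [Submodule.mem_orthogonal]
      intro u hu
      have := (Submodule.mem_orthogonal _ _).1 hg (U u) ⟨u, hu, rfl⟩
      simpa using this
    simpa [hU] using h.nonneg f hf

/-- The spectral subspace of `A` for `{g < 0}` splits the form of `g(A)`: it contains the range of
the negative part of `g(A)` and is contained in the kernel of the positive part. -/
theorem isNegativeSplit_spectralSubspace {E : Type*} [NormedAddCommGroup E]
    [InnerProductSpace ℂ E] [CompleteSpace E] (A : E →L[ℂ] E)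
    {g : ℝ → ℝ} (hg : Continuous g) :
    IsNegativeSplit (cfc g A) (spectralSubspace A {x | g x < 0}) := by
  have cont {f : ℝ → ℝ} (hf : Continuous f) : ContinuousOn f (spectrum ℝ A) := hf.continuousOn
  set sp : ℝ → ℝ := fun x => √(g x) with hsp
  set sm : ℝ → ℝ := fun x => √(-g x) with hsm
  have hspc : Continuous sp := hg.sqrt
  have hsmc : Continuous sm := hg.neg.sqrt
  -- The square roots of the positive and of the negative part of `g(A)`.
  set P : E →L[ℂ] E := cfc sp A with hP
  set M : E →L[ℂ] E := cfc sm A with hM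
  have hsplit : cfc g A = P * P - M * M := by
    rw [hP, hM, ← cfc_mul sp sp A (cont hspc) (cont hspc),
      ← cfc_mul sm sm A (cont hsmc) (cont hsmc),
      ← cfc_sub (fun x => sp x * sp x) (fun x => sm x * sm x) A (cont (hspc.mul hspc))
        (cont (hsmc.mul hsmc))]
    congr 1
    funext x
    simp only [hsp, hsm]
    rcases le_total 0 (g x) with h | h
    · rw [Real.mul_self_sqrt h, Real.sqrt_eq_zero_of_nonpos (by linarith : -g x ≤ 0)]
      ring
    · rw [Real.mul_self_sqrt (by linarith : 0 ≤ -g x), Real.sqrt_eq_zero_of_nonpos h]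
      ring
  have hPs : IsSelfAdjoint P := cfc_predicate sp A
  have hMs : IsSelfAdjoint M := cfc_predicate sm A
  have sq {T : E →L[ℂ] E} (hT : IsSelfAdjoint T) (f : E) :
      (inner ℂ f (T (T f))).re = ‖T f‖ ^ 2 := by
    rw [← ContinuousLinearMap.adjoint_inner_left, ← ContinuousLinearMap.star_eq_adjoint, hT.star_eq,
      inner_self_eq_norm_sq_to_K]
    norm_cast
  have hle : spectralSubspace A {x | g x < 0} ≤ LinearMap.ker P.toLinearMap := by
    refine Submodule.topologicalClosure_minimal _ (iSup₂_le fun f hf => ?_)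
      (ContinuousLinearMap.isClosed_ker P)
    rintro _ ⟨h, rfl⟩
    have hz : P * cfc f A = 0 := by
      rw [hP, ← cfc_mul sp f A (cont hspc) (cont hf.1)]
      rw [← cfc_const_zero ℝ A]
      congr 1
      funext x
      by_cases hx : g x < 0
      · simp [hsp, Real.sqrt_eq_zero_of_nonpos hx.le]
      · simp [hf.2 x hx]
    exact congrArg (fun T : E →L[ℂ] E => T h) hz
  have hker : ∀ f ∈ spectralSubspace A {x | g x < 0}, cfc g A f = -M (M f) := by
    intro f hf
    have : P f = 0 := hle hf
    simp [hsplit, this]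
  have hform : ∀ f ∈ spectralSubspace A {x | g x < 0},
      (inner ℂ f (cfc g A f)).re = -‖M f‖ ^ 2 := by
    intro f hf
    rw [hker f hf, inner_neg_right, Complex.neg_re, sq hMs]
  refine ⟨fun f hf => ?_, fun f hf h0 => ?_, fun f hf => ?_⟩
  · rw [hform f hf]
    exact neg_nonpos.2 (sq_nonneg _)
  · rw [hform f hf] at h0
    have : M f = 0 := by simpa using h0
    rw [hker f hf, this, map_zero, neg_zero]
  · have hmem : M (M f) ∈ spectralSubspace A {x | g x < 0} := by
      refine Submodule.le_topologicalClosure _ (Submodule.mem_iSup_of_mem sm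
        (Submodule.mem_iSup_of_mem ⟨hsmc, fun x hx => ?_⟩ ⟨M f, rfl⟩))
      exact Real.sqrt_eq_zero_of_nonpos (by simpa using hx)
    have h0 : M f = 0 := by
      have h1 := (Submodule.mem_orthogonal' _ _).1 hf _ hmem
      have h2 := sq hMs f
      rw [h1] at h2
      simpa using h2.symm
    have : cfc g A f = P (P f) := by simp [hsplit, h0]
    rw [this, sq hPs]
    positivity

theorem isNegativeSplit_spectralSubspace_Iio {E : Type*} [NormedAddCommGroup E]
    [InnerProductSpace ℂ E] [CompleteSpace E] {A : E →L[ℂ] E} (hA : IsSelfAdjoint A) :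
    IsNegativeSplit A (spectralSubspace A (Set.Iio 0)) := by
  have h := isNegativeSplit_spectralSubspace A continuous_id
  rwa [cfc_id ℝ A hA] at h

theorem isNegativeSplit_spectralSubspace_Ioi {E : Type*} [NormedAddCommGroup E]
    [InnerProductSpace ℂ E] [CompleteSpace E] {A : E →L[ℂ] E} (hA : IsSelfAdjoint A) (c : ℝ) :
    IsNegativeSplit ((c : ℂ) • 1 - A) (spectralSubspace A (Set.Ioi c)) := by
  have h := isNegativeSplit_spectralSubspace A (g := fun x => c - x) (by fun_prop)
  have hset : {x : ℝ | c - x < 0} = Set.Ioi c := by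
    ext x
    simp
  rwa [hset, cfc_sub (fun _ => c) (fun x => x) A (by fun_prop) (by fun_prop), cfc_const c A hA,
    cfc_id' ℝ A hA, Algebra.algebraMap_eq_smul_one, ← Complex.coe_smul] at h

/-- A linear map into `E` that meets `Kᗮ` only at `0` is injective after projecting to `K`. -/
theorem finrank_le_of_orthogonal {X E : Type*} [AddCommGroup X] [Module ℂ X]
    [NormedAddCommGroup E] [InnerProductSpace ℂ E] (K : Submodule ℂ E) [FiniteDimensional ℂ K]
    (T : X →ₗ[ℂ] E) (hT : ∀ x, T x ∈ Kᗮ → x = 0) : Module.finrank ℂ X ≤ Module.finrank ℂ K := by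
  refine LinearMap.finrank_le_finrank_of_injective
    (f := K.orthogonalProjectionOnto.toLinearMap ∘ₗ T) ?_
  refine (injective_iff_map_eq_zero _).2 fun x hx => hT x ?_
  exact Submodule.orthogonalProjectionOnto_eq_zero_iff.1 hx

/-! ### The trace of a projection -/

theorem hasSum_norm_sq (f : H) : HasSum (fun i => ‖f i‖ ^ 2) (‖f‖ ^ 2) := by
  simpa using lp.hasSum_norm (p := 2) (by norm_num) f

theorem trace_starProjection (K : Submodule ℂ H) [FiniteDimensional ℂ K] :
    trace K.starProjection = Module.finrank ℂ K := by
  set b := stdOrthonormalBasis ℂ K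
  have hsum (i : ℕ) : (inner ℂ (e i) (K.starProjection (e i))).re
      = ∑ j, ‖(b j : H) i‖ ^ 2 := by
    rw [b.starProjection_eq_sum_rankOne]
    simp only [_root_.sum_apply, inner_sum, InnerProductSpace.rankOne_apply, inner_smul_right,
      inner_e, Complex.re_sum]
    refine Finset.sum_congr rfl fun j _ => ?_
    rw [← inner_conj_symm, inner_e, Complex.conj_mul']
    norm_cast
  have hone (j) : ∑' i, ENNReal.ofReal (‖(b j : H) i‖ ^ 2) = 1 := by
    have h := hasSum_norm_sq (b j : H)
    rw [← ENNReal.ofReal_tsum_of_nonneg (fun _ => sq_nonneg _) h.summable, h.tsum_eq]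
    have : ‖(b j : H)‖ = 1 := b.orthonormal.1 j
    simp [this]
  simp only [trace, hsum]
  simp_rw [ENNReal.ofReal_sum_of_nonneg fun j (_ : j ∈ Finset.univ) => sq_nonneg _]
  rw [Summable.tsum_finsetSum fun _ _ => ENNReal.summable]
  simp only [hone, Finset.sum_const, Finset.card_univ, Fintype.card_fin, nsmul_eq_mul, mul_one]

/-! ### Negative index of a Hermitian form in finite dimension -/

/-- The form of `T` is negative definite on `G`. -/
def IsNegativeOn {E : Type*} [NormedAddCommGroup E] [InnerProductSpace ℂ E]
    (T : E →ₗ[ℂ] E) (G : Submodule ℂ E) : Prop :=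
  ∀ x ∈ G, x ≠ 0 → (inner ℂ x (T x)).re < 0

/-- `d` is the largest dimension of a subspace on which the form of `T` is negative definite. -/
def IsNegIndex {E : Type*} [NormedAddCommGroup E] [InnerProductSpace ℂ E]
    (T : E →ₗ[ℂ] E) (d : ℕ) : Prop :=
  (∃ G : Submodule ℂ E, Module.finrank ℂ G = d ∧ IsNegativeOn T G) ∧
    ∀ G : Submodule ℂ E, IsNegativeOn T G → Module.finrank ℂ G ≤ d

theorem IsNegIndex.unique {E : Type*} [NormedAddCommGroup E] [InnerProductSpace ℂ E]
    {T : E →ₗ[ℂ] E} {d d' : ℕ} (h : IsNegIndex T d) (h' : IsNegIndex T d') : d = d' := by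
  obtain ⟨⟨G, rfl, hG⟩, hle⟩ := h
  obtain ⟨⟨G', rfl, hG'⟩, hle'⟩ := h'
  exact le_antisymm (hle' G hG) (hle G' hG')

/-- The span `N` of the eigenvectors with negative eigenvalue, with uniform bounds for the form. -/
theorem exists_uniform_negative_subspace {E : Type*} [NormedAddCommGroup E]
    [InnerProductSpace ℂ E] [FiniteDimensional ℂ E] {T : E →ₗ[ℂ] E} (hT : T.IsSymmetric) :
    ∃ N : Submodule ℂ E, ∃ c > 0, (∀ x ∈ N, (inner ℂ x (T x)).re ≤ -c * ‖x‖ ^ 2) ∧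
      (∀ x ∈ Nᗮ, 0 ≤ (inner ℂ x (T x)).re) ∧
      (Function.Injective T → ∀ x ∈ Nᗮ, c * ‖x‖ ^ 2 ≤ (inner ℂ x (T x)).re) := by
  set u := hT.eigenvectorBasis rfl
  set l := hT.eigenvalues rfl
  have hTu (i) : T (u i) = (l i : ℂ) • u i := hT.apply_eigenvectorBasis rfl i
  have hform (x : E) : (inner ℂ x (T x)).re = ∑ i, l i * ‖inner ℂ (u i) x‖ ^ 2 := by
    rw [← u.sum_inner_mul_inner, Complex.re_sum]
    refine Finset.sum_congr rfl fun i _ => ?_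
    rw [← hT (u i) x, hTu, inner_smul_left, Complex.conj_ofReal, ← inner_conj_symm x (u i),
      mul_left_comm, Complex.conj_mul']
    norm_cast
  have hnorm (x : E) : ‖x‖ ^ 2 = ∑ i, ‖inner ℂ (u i) x‖ ^ 2 := (u.sum_sq_norm_inner_right x).symm
  obtain ⟨c, hc, hcl⟩ : ∃ c > 0, ∀ i, l i ≠ 0 → c ≤ |l i| := by
    have : ∀ᶠ c in 𝓝[>] (0 : ℝ), ∀ i, l i ≠ 0 → c ≤ |l i| := by
      refine eventually_all.2 fun i => ?_
      by_cases h : l i = 0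
      · simp [h]
      · filter_upwards [Ioo_mem_nhdsGT (abs_pos.2 h)] with c hc _ using hc.2.le
    obtain ⟨c, h1, h2⟩ := (this.and self_mem_nhdsWithin).exists
    exact ⟨c, h2, h1⟩
  have hperp (x : E) (hx : x ∈ (Submodule.span ℂ (u '' {i | l i < 0}))ᗮ) (i) (hi : l i < 0) :
      inner ℂ (u i) x = 0 :=
    (Submodule.mem_orthogonal _ _).1 hx _ (Submodule.subset_span ⟨i, hi, rfl⟩)
  refine ⟨Submodule.span ℂ (u '' {i | l i < 0}), c, hc, fun x hx => ?_, fun x hx => ?_,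
    fun hinj x hx => ?_⟩
  · rw [hform, hnorm, Finset.mul_sum]
    refine Finset.sum_le_sum fun i _ => ?_
    by_cases hi : l i < 0
    · have := hcl i hi.ne
      rw [abs_of_neg hi] at this
      exact mul_le_mul_of_nonneg_right (by linarith) (sq_nonneg _)
    · have : inner ℂ (u i) x = 0 := by
        induction hx using Submodule.span_induction with
        | mem y hy =>
          obtain ⟨k, hk, rfl⟩ := hy
          exact u.orthonormal.2 fun h => hi (h ▸ hk)
        | zero => simp
        | add y z _ _ hy hz => rw [inner_add_right, hy, hz, add_zero]
        | smul a y _ hy => rw [inner_smul_right, hy, mul_zero]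
      simp [this]
  · rw [hform]
    refine Finset.sum_nonneg fun i _ => ?_
    by_cases hi : l i < 0
    · simp [hperp x hx i hi]
    · exact mul_nonneg (not_lt.1 hi) (sq_nonneg _)
  · rw [hform, hnorm, Finset.mul_sum]
    refine Finset.sum_le_sum fun i _ => ?_
    by_cases hi : l i < 0
    · simp [hperp x hx i hi]
    · have h0 : l i ≠ 0 := by
        intro h0
        have h1 : T (u i) = T 0 := by rw [hTu, h0]; simp
        exact u.orthonormal.ne_zero i (hinj h1)
      have := hcl i h0
      rw [abs_of_nonneg (not_lt.1 hi)] at this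
      exact mul_le_mul_of_nonneg_right this (sq_nonneg _)

theorem IsNegativeOn.finrank_le {E : Type*} [NormedAddCommGroup E] [InnerProductSpace ℂ E]
    {T : E →ₗ[ℂ] E} {G N : Submodule ℂ E} [FiniteDimensional ℂ N] (hG : IsNegativeOn T G)
    (hN : ∀ x ∈ Nᗮ, 0 ≤ (inner ℂ x (T x)).re) : Module.finrank ℂ G ≤ Module.finrank ℂ N := by
  refine finrank_le_of_orthogonal N G.subtype fun x hx => ?_
  by_contra h
  exact (hG x x.2 (by simpa using h)).not_ge (hN _ hx)

/-- The index of a nondegenerate form is stable: the negative and the positive spectral subspaces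
keep the sign of the form under small perturbations. -/
theorem IsNegIndex.stable {E : Type*} [NormedAddCommGroup E] [InnerProductSpace ℂ E]
    [FiniteDimensional ℂ E] {T : E →ₗ[ℂ] E} (hT : T.IsSymmetric) (hinj : Function.Injective T)
    {d : ℕ} (hd : IsNegIndex T d) :
    ∃ δ > 0, ∀ T' : E →ₗ[ℂ] E,
      (∀ x, |(inner ℂ x (T' x)).re - (inner ℂ x (T x)).re| ≤ δ * ‖x‖ ^ 2) → IsNegIndex T' d := by
  obtain ⟨N, c, hc, hneg, hnonneg, hpos⟩ := exists_uniform_negative_subspace hT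
  have hind {T' : E →ₗ[ℂ] E} (h1 : IsNegativeOn T' N)
      (h2 : ∀ x ∈ Nᗮ, 0 ≤ (inner ℂ x (T' x)).re) : IsNegIndex T' (Module.finrank ℂ N) :=
    ⟨⟨N, rfl, h1⟩, fun G hG => hG.finrank_le h2⟩
  have hsq {x : E} (hx : x ≠ 0) : 0 < c * ‖x‖ ^ 2 := by positivity
  have hd' : d = Module.finrank ℂ N :=
    hd.unique (hind (fun x hx h0 => by linarith [hneg x hx, hsq h0]) hnonneg)
  refine ⟨c / 2, half_pos hc, fun T' hT' => hd' ▸ hind (fun x hx h0 => ?_) (fun x hx => ?_)⟩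
  · linarith [(abs_le.1 (hT' x)).2, hneg x hx, hsq h0]
  · have := (abs_le.1 (hT' x)).1
    have h0 : 0 ≤ c * ‖x‖ ^ 2 := by positivity
    linarith [hpos hinj x hx]

/-- Lowering a degenerate form so that it becomes negative on a vector of the kernel raises the
index. -/
theorem IsNegIndex.lt_of_kernel {E : Type*} [NormedAddCommGroup E] [InnerProductSpace ℂ E]
    [FiniteDimensional ℂ E] {T T' : E →ₗ[ℂ] E} (hT : T.IsSymmetric) {d d' : ℕ}
    (hd : IsNegIndex T d) (hd' : IsNegIndex T' d')
    (hle : ∀ x, (inner ℂ x (T' x)).re ≤ (inner ℂ x (T x)).re) {x : E} (hx : T x = 0)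
    (hneg : (inner ℂ x (T' x)).re < 0) : d < d' := by
  obtain ⟨⟨G, rfl, hG⟩, -⟩ := hd
  have hx0 : x ≠ 0 := by
    rintro rfl
    simp at hneg
  have hxG : x ∉ G := fun h => by simpa [hx] using hG x h hx0
  have hlt : G < G ⊔ Submodule.span ℂ {x} :=
    left_lt_sup.2 fun h => hxG (h (Submodule.mem_span_singleton_self x))
  refine (Submodule.finrank_lt_finrank_of_lt hlt).trans_le (hd'.2 _ ?_)
  intro y hy hy0
  obtain ⟨g, hg, z, hz, rfl⟩ := Submodule.mem_sup.1 hy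
  obtain ⟨c, rfl⟩ := Submodule.mem_span_singleton.1 hz
  -- The vector `x` does not contribute to the form of `T`, so only `g = 0` needs the strict drop.
  by_cases hg0 : g = 0
  · subst hg0
    have hc : c ≠ 0 := by
      rintro rfl
      simp at hy0
    have : (inner ℂ (0 + c • x) (T' (0 + c • x))).re = ‖c‖ ^ 2 * (inner ℂ x (T' x)).re := by
      rw [zero_add, map_smul, inner_smul_left, inner_smul_right, ← mul_assoc, Complex.conj_mul',
        ← Complex.ofReal_pow, Complex.re_ofReal_mul]
    rw [this]
    exact mul_neg_of_pos_of_neg (by positivity) hneg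
  · have : inner ℂ (g + c • x) (T (g + c • x)) = inner ℂ g (T g) := by
      rw [map_add, map_smul, hx, smul_zero, add_zero, inner_add_left, inner_smul_left,
        ← hT x g, hx, inner_zero_left, mul_zero, add_zero]
    have h1 := hle (g + c • x)
    rw [this] at h1
    exact h1.trans_lt (hG g hg hg0)

/-! ### The energy of a sequence -/

theorem matrixAct_add (n : ℕ) (v : ℕ → ℝ) (φ ψ : ℕ → ℂ) (i : ℕ) :
    matrixAct n v (φ + ψ) i = matrixAct n v φ i + matrixAct n v ψ i := by
  cases i <;> simp only [matrixAct, Pi.add_apply] <;> ring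

theorem matrixAct_smul (n : ℕ) (v : ℕ → ℝ) (c : ℂ) (ψ : ℕ → ℂ) (i : ℕ) :
    matrixAct n v (c • ψ) i = c * matrixAct n v ψ i := by
  cases i <;> simp only [matrixAct, Pi.smul_apply, smul_eq_mul] <;> ring

/-- The first-order differences whose squares add up to the form of `J`. -/
noncomputable def bond (ψ : ℕ → ℂ) : ℕ → ℂ
  | 0 => √2 * ψ 0 - ψ 1
  | k + 1 => ψ (k + 1) - ψ (k + 2)

/-- The form of `J + P_n V P_n` on a sequence, cut off after the first `N + 1` bonds. -/
noncomputable def energy (n : ℕ) (v : ℕ → ℝ) (N : ℕ) (ψ : ℕ → ℂ) : ℝ :=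
  ∑ k ∈ Finset.range (N + 1), ‖bond ψ k‖ ^ 2 + ∑ i ∈ Finset.range (N + 2), pot n v i * ‖ψ i‖ ^ 2

theorem energy_succ_eq (n : ℕ) (v : ℕ → ℝ) (N : ℕ) (ψ : ℕ → ℂ) : energy n v (N + 1) ψ
    = energy n v N ψ + ‖bond ψ (N + 1)‖ ^ 2 + pot n v (N + 2) * ‖ψ (N + 2)‖ ^ 2 := by
  rw [energy, energy, Finset.sum_range_succ (fun k => ‖bond ψ k‖ ^ 2) (N + 1),
    Finset.sum_range_succ (fun i => pot n v i * ‖ψ i‖ ^ 2) (N + 2)]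
  ring

/-- Summation by parts for the form of `J + P_n V P_n`. -/
theorem sum_conj_mul_matrixAct (n : ℕ) (v : ℕ → ℝ) (ψ : ℕ → ℂ) (N : ℕ) :
    ∑ i ∈ Finset.range (N + 2), conj (ψ i) * matrixAct n v ψ i
      = energy n v N ψ + conj (ψ (N + 1)) * bond ψ (N + 1) := by
  have hs : (√2 : ℂ) ^ 2 = 2 := by
    norm_cast
    simp
  induction N with
  | zero =>
    simp only [energy, Finset.sum_range_succ, Finset.sum_range_zero]
    push_cast
    simp only [← Complex.conj_mul', bond, matrixAct, a, map_sub, map_mul, Complex.conj_ofReal]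
    push_cast
    linear_combination (-conj (ψ 0) * ψ 0) * hs
  | succ N ih =>
    rw [Finset.sum_range_succ, ih, energy_succ_eq]
    push_cast
    simp only [← Complex.conj_mul', bond, matrixAct, a, map_sub]
    push_cast
    ring

theorem energy_congr (n : ℕ) (v : ℕ → ℝ) {N : ℕ} {φ ψ : ℕ → ℂ} (h : ∀ i ≤ N + 1, φ i = ψ i) :
    energy n v N φ = energy n v N ψ := by
  unfold energy
  congr 1
  · refine Finset.sum_congr rfl fun k hk => ?_
    have hk := Finset.mem_range.1 hk
    cases k with
    | zero => simp only [bond, h 0 (by omega), h 1 (by omega)]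
    | succ k => simp only [bond, h (k + 1) (by omega), h (k + 2) (by omega)]
  · refine Finset.sum_congr rfl fun i hi => ?_
    rw [h i (by have := Finset.mem_range.1 hi; omega)]

theorem energy_succ {n : ℕ} (v : ℕ → ℝ) {N : ℕ} (hN : n ≤ N + 2) (ψ : ℕ → ℂ) :
    energy n v (N + 1) ψ = energy n v N ψ + ‖bond ψ (N + 1)‖ ^ 2 := by
  have : pot n v (N + 2) = 0 := if_neg (by omega)
  rw [energy_succ_eq, this, zero_mul, add_zero]

theorem energy_mono {n : ℕ} (v : ℕ → ℝ) {N L : ℕ} (hN : n ≤ N + 2) (hL : N ≤ L) (ψ : ℕ → ℂ) :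
    energy n v N ψ ≤ energy n v L ψ := by
  induction L, hL using Nat.le_induction with
  | base => exact le_rfl
  | succ L hL ih =>
    rw [energy_succ v (by omega)]
    exact ih.trans (le_add_of_nonneg_right (sq_nonneg _))

theorem tendsto_coe_zero (f : H) : Tendsto (fun i => f i) atTop (𝓝 0) := by
  have h := (hasSum_norm_sq f).summable.tendsto_atTop_zero
  rw [tendsto_zero_iff_norm_tendsto_zero]
  have := h.sqrt
  simpa using this

/-- The form of the operator `J + P_n V P_n` is the limit of the energies. -/
theorem tendsto_energy (n : ℕ) (v : ℕ → ℝ) (f : H) :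
    Tendsto (fun L => energy n v L f) atTop (𝓝 (inner ℂ f ((J + diagOp n v) f)).re) := by
  have h1 := ((lp.hasSum_inner (𝕜 := ℂ) f ((J + diagOp n v) f)).tendsto_sum_nat.comp
    (tendsto_add_atTop_nat 2))
  have h2 : Tendsto (fun L => conj (f (L + 1)) * bond f (L + 1)) atTop (𝓝 0) := by
    have h3 := tendsto_coe_zero f
    have h4 := h3.comp (tendsto_add_atTop_nat 1)
    have h5 := h3.comp (tendsto_add_atTop_nat 2)
    have h6 := ((Complex.continuous_conj.tendsto 0).comp h4).mul (h4.sub h5)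
    simpa [bond, Function.comp_def] using h6
  have h7 := (Complex.continuous_re.tendsto _).comp (h1.sub h2)
  rw [sub_zero] at h7
  refine h7.congr fun L => ?_
  have h8 := sum_conj_mul_matrixAct n v f L
  have h9 : ∑ i ∈ Finset.range (L + 2), (inner ℂ (f i) (((J + diagOp n v) f : H) i) : ℂ)
      = ∑ i ∈ Finset.range (L + 2), conj (f i) * matrixAct n v f i := by
    refine Finset.sum_congr rfl fun i _ => ?_
    rw [add_apply, RCLike.inner_apply, mul_comm]
  simp only [Function.comp_apply]
  rw [h9, h8, add_sub_cancel_right, Complex.ofReal_re]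

theorem energy_le_inner {n : ℕ} (v : ℕ → ℝ) {N : ℕ} (hN : n ≤ N + 2) (f : H) :
    energy n v N f ≤ (inner ℂ f ((J + diagOp n v) f)).re :=
  ge_of_tendsto (tendsto_energy n v f) <| by
    filter_upwards [eventually_ge_atTop N] with L hL using energy_mono v hN hL f

/-- Equality in `energy_le_inner` forces `f` to be constant, hence zero, beyond the sites that enter
the energy. -/
theorem eq_zero_of_inner_le_energy {n : ℕ} (v : ℕ → ℝ) {N : ℕ} (hN : n ≤ N + 2) {f : H}
    (h : (inner ℂ f ((J + diagOp n v) f)).re ≤ energy n v N f) {i : ℕ} (hi : N + 1 ≤ i) :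
    f i = 0 := by
  have hb (k : ℕ) (hk : N + 1 ≤ k) : f k = f (k + 1) := by
    obtain ⟨k, rfl⟩ : ∃ m, k = m + 1 := ⟨k - 1, by omega⟩
    have h1 := energy_le_inner (n := n) v (N := k + 1) (by omega) f
    have h2 := energy_mono v (L := k) hN (by omega) f
    rw [energy_succ (n := n) v (by omega)] at h1
    have h3 : ‖bond f (k + 1)‖ ^ 2 = 0 := le_antisymm (by linarith) (sq_nonneg _)
    have h4 : bond f (k + 1) = 0 := by simpa using h3
    exact sub_eq_zero.1 h4
  have hc (k : ℕ) (hk : i ≤ k) : f k = f i := by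
    induction k, hk using Nat.le_induction with
    | base => rfl
    | succ k hk ih => rw [← hb k (by omega), ih]
  refine tendsto_nhds_unique (tendsto_const_nhds.congr' ?_) (tendsto_coe_zero f)
  filter_upwards [eventually_ge_atTop i] with k hk using (hc k hk).symm

/-- A solution that vanishes far out vanishes everywhere. -/
theorem eq_zero_of_recurrence {b : ℕ → ℂ} {ψ : ℕ → ℂ}
    (h : ∀ i, a (i + 1) * ψ i + b i * ψ (i + 1) + a (i + 2) * ψ (i + 2) = 0)
    {M : ℕ} (h0 : ∀ i, M ≤ i → ψ i = 0) (i : ℕ) : ψ i = 0 := by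
  induction M with
  | zero => exact h0 i i.zero_le
  | succ M ih =>
    refine ih fun k hk => ?_
    rcases hk.eq_or_lt with rfl | hk
    · have := h M
      rw [h0 (M + 1) le_rfl, h0 (M + 2) (by omega), mul_zero, mul_zero, add_zero, add_zero] at this
      exact (mul_eq_zero.1 this).resolve_left (by exact_mod_cast a_ne_zero (M + 1))
    · exact h0 k hk

/-- A zero-energy solution that vanishes at the first site vanishes everywhere. -/
theorem eq_zero_of_matrixAct_eq_zero {n : ℕ} {v : ℕ → ℝ} {ψ : ℕ → ℂ}
    (h : ∀ i, matrixAct n v ψ i = 0) (h0 : ψ 0 = 0) (i : ℕ) : ψ i = 0 := by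
  suffices ψ i = 0 ∧ ψ (i + 1) = 0 from this.1
  induction i with
  | zero =>
    have := h 0
    simp only [matrixAct, h0, mul_zero, zero_add] at this
    exact ⟨h0, (mul_eq_zero.1 this).resolve_left (by exact_mod_cast a_ne_zero 1)⟩
  | succ i ih =>
    have := h (i + 1)
    simp only [matrixAct, ih.1, ih.2, mul_zero, zero_add] at this
    exact ⟨ih.2, (mul_eq_zero.1 this).resolve_left (by exact_mod_cast a_ne_zero (i + 2))⟩

/-! ### The threshold matrix -/

/-- The column `x`, continued to the right by its last entry. -/
def extend (N : ℕ) : EuclideanSpace ℂ (Fin (N + 2)) →ₗ[ℂ] (ℕ → ℂ) where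
  toFun x i := x ⟨min i (N + 1), by omega⟩
  map_add' _ _ := rfl
  map_smul' _ _ := rfl

/-- The first `N + 2` entries of a sequence. -/
def restrict (N : ℕ) : H →ₗ[ℂ] EuclideanSpace ℂ (Fin (N + 2)) where
  toFun f := WithLp.toLp 2 fun i => f i
  map_add' _ _ := rfl
  map_smul' _ _ := rfl

/-- The truncation of `J + P_n V P_n` to the first `N + 2` sites, with the boundary condition
`ψ_{N+3} = ψ_{N+2}` obeyed by solutions that are constant to the right. -/
noncomputable def thresholdMatrix (n : ℕ) (v : ℕ → ℝ) (N : ℕ) :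
    EuclideanSpace ℂ (Fin (N + 2)) →ₗ[ℂ] EuclideanSpace ℂ (Fin (N + 2)) where
  toFun x := WithLp.toLp 2 fun i => matrixAct n v (extend N x) i
  map_add' x y := by
    ext i
    simp [matrixAct_add]
  map_smul' c x := by
    ext i
    simp [matrixAct_smul]

theorem extend_of_le {N i : ℕ} (hi : N + 1 ≤ i) (x : EuclideanSpace ℂ (Fin (N + 2))) :
    extend N x i = x (Fin.last _) := by
  refine congrArg (fun j => x j) (Fin.ext ?_)
  simp [hi]

theorem extend_val {N : ℕ} (x : EuclideanSpace ℂ (Fin (N + 2))) (i : Fin (N + 2)) :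
    extend N x i = x i := by
  refine congrArg (fun j => x j) (Fin.ext ?_)
  simp only [inf_eq_left]
  omega

theorem extend_restrict {N : ℕ} (f : H) {i : ℕ} (hi : i ≤ N + 1) :
    extend N (restrict N f) i = f i := by
  have := extend_val (restrict N f) ⟨i, by omega⟩
  exact this

theorem inner_thresholdMatrix (n : ℕ) (v : ℕ → ℝ) (N : ℕ) (x : EuclideanSpace ℂ (Fin (N + 2))) :
    inner ℂ x (thresholdMatrix n v N x) = energy n v N (extend N x) := by
  have h := sum_conj_mul_matrixAct n v (extend N x) N
  have hb : bond (extend N x) (N + 1) = 0 := by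
    simp only [bond]
    rw [extend_of_le le_rfl, extend_of_le (by omega), sub_self]
  rw [hb, mul_zero, add_zero] at h
  rw [← h, PiLp.inner_apply,
    ← Fin.sum_univ_eq_sum_range (fun i => conj (extend N x i) * matrixAct n v (extend N x) i)]
  refine Finset.sum_congr rfl fun i _ => ?_
  rw [extend_val, RCLike.inner_apply, mul_comm]
  rfl

theorem inner_thresholdMatrix_re (n : ℕ) (v : ℕ → ℝ) (N : ℕ)
    (x : EuclideanSpace ℂ (Fin (N + 2))) :
    (inner ℂ x (thresholdMatrix n v N x)).re = energy n v N (extend N x) := by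
  rw [inner_thresholdMatrix, Complex.ofReal_re]

theorem thresholdMatrix_isSymmetric (n : ℕ) (v : ℕ → ℝ) (N : ℕ) :
    (thresholdMatrix n v N).IsSymmetric := by
  rw [LinearMap.isSymmetric_iff_inner_map_self_real]
  intro x
  rw [inner_conj_symm, inner_thresholdMatrix, ← inner_conj_symm, inner_thresholdMatrix,
    Complex.conj_ofReal]

theorem matrixAct_extend_eq_zero {n : ℕ} {v : ℕ → ℝ} {N : ℕ} (hN : n ≤ N + 2)
    {x : EuclideanSpace ℂ (Fin (N + 2))} (hx : thresholdMatrix n v N x = 0) (i : ℕ) :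
    matrixAct n v (extend N x) i = 0 := by
  by_cases hi : i < N + 2
  · exact congrArg (fun y : EuclideanSpace ℂ (Fin (N + 2)) => y ⟨i, hi⟩) hx
  · obtain ⟨k, rfl⟩ : ∃ k, i = k + 2 := ⟨i - 2, by omega⟩
    have hp : pot n v (k + 2) = 0 := if_neg (by omega)
    simp only [matrixAct, hp, extend_of_le (show N + 1 ≤ k + 1 by omega),
      extend_of_le (show N + 1 ≤ k + 1 + 1 by omega),
      extend_of_le (show N + 1 ≤ k + 1 + 2 by omega)]
    simp only [a]
    push_cast
    ring

/-! ### Slowly decaying continuations -/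

/-- The profile that equals `1` up to `N + 1` and then decays linearly to `0` in `L + 1` steps. -/
noncomputable def decay (N L i : ℕ) : ℝ := ((L + 1 - (i - (N + 1)) : ℕ) : ℝ) / (L + 1)

theorem decay_of_le {N i : ℕ} (L : ℕ) (hi : i ≤ N + 1) : decay N L i = 1 := by
  have : i - (N + 1) = 0 := by omega
  rw [decay, this]
  push_cast
  exact div_self (by positivity)

theorem decay_nonneg (N L i : ℕ) : 0 ≤ decay N L i := by
  unfold decay
  positivity

theorem decay_of_ge {N L i : ℕ} (hi : N + L + 2 ≤ i) : decay N L i = 0 := by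
  have : L + 1 - (i - (N + 1)) = 0 := by omega
  simp [decay, this]

theorem sq_decay_sub_le (N L i : ℕ) :
    (decay N L i - decay N L (i + 1)) ^ 2
      ≤ (decay N L i - decay N L (i + 1)) * (1 / ((L : ℝ) + 1)) := by
  have h : decay N L i - decay N L (i + 1) = 0 ∨
      decay N L i - decay N L (i + 1) = 1 / ((L : ℝ) + 1) := by
    rcases (show L + 1 - (i - (N + 1)) = L + 1 - (i + 1 - (N + 1)) ∨
      L + 1 - (i - (N + 1)) = L + 1 - (i + 1 - (N + 1)) + 1 by omega) with h | h
    · left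
      rw [decay, decay, h, sub_self]
    · right
      rw [decay, decay, h]
      push_cast
      ring
  rcases h with h | h <;> rw [h] <;> simp [sq]

/-- The continuation of a column by its last entry, damped by `decay`. -/
noncomputable def slowExtend (N L : ℕ) : EuclideanSpace ℂ (Fin (N + 2)) →ₗ[ℂ] H where
  toFun x := ⟨fun i => decay N L i * extend N x i, memℓp_gen (by
    refine summable_of_ne_finset_zero (s := Finset.range (N + L + 2)) fun i hi => ?_
    rw [decay_of_ge (by simpa using hi)]
    simp)⟩
  map_add' x y := by
    ext i
    change (decay N L i : ℂ) * _ = decay N L i * _ + decay N L i * _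
    rw [map_add, Pi.add_apply, mul_add]
  map_smul' c x := by
    ext i
    change (decay N L i : ℂ) * _ = c * (decay N L i * _)
    rw [map_smul, Pi.smul_apply, smul_eq_mul, mul_left_comm]

theorem slowExtend_apply (N L : ℕ) (x : EuclideanSpace ℂ (Fin (N + 2))) (i : ℕ) :
    slowExtend N L x i = decay N L i * extend N x i := rfl

/-- The tail of a slowly decaying continuation costs arbitrarily little energy. -/
theorem inner_slowExtend_le {n : ℕ} (v : ℕ → ℝ) {N : ℕ} (hN : n ≤ N + 2) (L : ℕ)
    (x : EuclideanSpace ℂ (Fin (N + 2))) :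
    (inner ℂ (slowExtend N L x) ((J + diagOp n v) (slowExtend N L x))).re
      ≤ (inner ℂ x (thresholdMatrix n v N x)).re + ‖x‖ ^ 2 * (1 / ((L : ℝ) + 1)) := by
  set y := x (Fin.last _)
  have hy : ‖y‖ ^ 2 ≤ ‖x‖ ^ 2 := by
    gcongr
    exact PiLp.norm_apply_le x _
  have hstep (j : ℕ) : energy n v (N + j) (slowExtend N L x)
      ≤ energy n v N (extend N x)
        + ‖y‖ ^ 2 * ((1 - decay N L (N + 1 + j)) * (1 / ((L : ℝ) + 1))) := by
    induction j with
    | zero =>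
      rw [add_zero, add_zero, decay_of_le L le_rfl, sub_self, zero_mul, mul_zero, add_zero]
      refine (energy_congr n v fun i hi => ?_).le
      rw [slowExtend_apply, decay_of_le L hi]
      simp
    | succ j ih =>
      rw [← add_assoc, energy_succ v (by omega)]
      have hb : bond (slowExtend N L x) (N + j + 1)
          = ((decay N L (N + 1 + j) - decay N L (N + 1 + j + 1) : ℝ) : ℂ) * y := by
        simp only [bond, slowExtend_apply]
        rw [extend_of_le (by omega), extend_of_le (by omega),
          show N + j + 1 = N + 1 + j by omega, show N + j + 2 = N + 1 + j + 1 by omega]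
        push_cast
        ring
      rw [hb, norm_mul, mul_pow, Complex.norm_real, Real.norm_eq_abs, sq_abs, ← add_assoc]
      have h1 := mul_le_mul_of_nonneg_right (sq_decay_sub_le N L (N + 1 + j)) (sq_nonneg ‖y‖)
      calc _ ≤ _ := add_le_add ih h1
        _ = _ := by ring
  rw [inner_thresholdMatrix_re]
  refine le_of_tendsto (tendsto_energy n v _) ?_
  filter_upwards [eventually_ge_atTop N] with k hk
  obtain ⟨j, rfl⟩ := Nat.exists_eq_add_of_le hk
  refine (hstep j).trans (add_le_add_right ?_ _)
  have hL : 0 ≤ 1 / ((L : ℝ) + 1) := by positivity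
  have hd : (1 - decay N L (N + 1 + j)) * (1 / ((L : ℝ) + 1)) ≤ 1 / ((L : ℝ) + 1) :=
    mul_le_of_le_one_left hL (by linarith [decay_nonneg N L (N + 1 + j)])
  exact (mul_le_mul_of_nonneg_left hd (sq_nonneg _)).trans (mul_le_mul_of_nonneg_right hy hL)

/-! ### Counting eigenvalues by the threshold matrix -/

/-- A negative spectral subspace of `J + P_n V P_n` has the dimension of the negative index of the
threshold matrix: restriction to the first `N + 2` sites does not increase the form, and a slowly
decaying continuation increases it arbitrarily little. -/
theorem IsNegativeSplit.isNegIndex {n : ℕ} {v : ℕ → ℝ} {N : ℕ} (hN : n ≤ N + 2)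
    {K : Submodule ℂ H} (hK : IsNegativeSplit (J + diagOp n v) K) :
    FiniteDimensional ℂ K ∧ IsNegIndex (thresholdMatrix n v N) (Module.finrank ℂ K) := by
  have hres (f : H) : (inner ℂ (restrict N f) (thresholdMatrix n v N (restrict N f))).re
      = energy n v N f := by
    rw [inner_thresholdMatrix_re]
    exact energy_congr n v fun i hi => extend_restrict f hi
  have hneg (f : H) (hf : f ∈ K) (h0 : f ≠ 0) : energy n v N f < 0 := by
    by_contra! h
    -- Otherwise `f` is a zero-energy solution that vanishes far out.
    have h1 := energy_le_inner v hN f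
    have h2 := hK.nonpos f hf
    have h3 : (J + diagOp n v) f = 0 := hK.apply_eq_zero f hf (by linarith)
    have h4 (i : ℕ) : matrixAct n v f i = 0 := by
      rw [← add_apply, h3]
      rfl
    refine h0 (lp.ext (funext fun i => ?_))
    exact eq_zero_of_recurrence (fun i => h4 (i + 1))
      (fun i hi => eq_zero_of_inner_le_energy v hN (h2.trans h) hi) i
  have hinj : Function.Injective (restrict N ∘ₗ K.subtype) := by
    refine (injective_iff_map_eq_zero _).2 fun f hf => ?_
    by_contra h0
    have h1 := hneg f f.2 (by simpa using h0)
    have h2 : restrict N f = 0 := hf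
    rw [← hres, h2] at h1
    simp at h1
  have hfin : FiniteDimensional ℂ K := FiniteDimensional.of_injective _ hinj
  refine ⟨hfin, ⟨LinearMap.range (restrict N ∘ₗ K.subtype),
    LinearMap.finrank_range_of_inj hinj, ?_⟩, fun G hG => ?_⟩
  · rintro _ ⟨f, rfl⟩ h0
    have : (f : H) ≠ 0 := by
      intro h
      simp [h] at h0
    exact (hres f).trans_lt (hneg f f.2 this)
  · obtain ⟨G', c, hc, hG', hperp, -⟩ :=
      exists_uniform_negative_subspace (thresholdMatrix_isSymmetric n v N)
    refine (hG.finrank_le hperp).trans ?_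
    -- The uniform bound `-c ‖x‖²` absorbs the energy of the tail once `1 / (L + 1) < c`.
    obtain ⟨L, hL⟩ := exists_nat_one_div_lt hc
    refine finrank_le_of_orthogonal K (slowExtend N L ∘ₗ G'.subtype) fun x hx => ?_
    have h1 := hK.nonneg _ hx
    have h2 := inner_slowExtend_le v hN L (x : EuclideanSpace ℂ (Fin (N + 2)))
    have h3 := hG' x x.2
    by_contra h0
    have h4 : 0 < ‖(x : EuclideanSpace ℂ (Fin (N + 2)))‖ ^ 2 := by
      have : (x : EuclideanSpace ℂ (Fin (N + 2))) ≠ 0 := by simpa using h0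
      positivity
    have h5 := mul_lt_mul_of_pos_left hL h4
    simp only [LinearMap.comp_apply, Submodule.subtype_apply] at h1
    linarith

theorem exists_countBelow_eq (n : ℕ) (v : ℕ → ℝ) :
    ∃ d : ℕ, countBelow (diagOp n v) = d ∧ IsNegIndex (thresholdMatrix n v (n - 2)) d := by
  obtain ⟨hfin, hd⟩ := (isNegativeSplit_spectralSubspace_Iio
    (isSelfAdjoint_add n v)).isNegIndex (N := n - 2) (by omega)
  exact ⟨_, trace_starProjection _, hd⟩

/-! ### Reflection of the spectrum -/

/-- The unitary `δ_k ↦ (-1) ^ (k + 1) δ_k`. -/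
noncomputable def alternate : H ≃ₗᵢ[ℂ] H where
  toFun f := ⟨fun i => (-1) ^ i * f i, by
    have := (memℓp_gen_iff (by norm_num)).1 (lp.memℓp f)
    exact memℓp_gen (by simpa using this)⟩
  invFun f := ⟨fun i => (-1) ^ i * f i, by
    have := (memℓp_gen_iff (by norm_num)).1 (lp.memℓp f)
    exact memℓp_gen (by simpa using this)⟩
  map_add' f g := by
    ext i
    exact mul_add ((-1 : ℂ) ^ i) (f i) (g i)
  map_smul' c f := by
    ext i
    exact mul_left_comm ((-1 : ℂ) ^ i) c (f i)
  left_inv f := by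
    ext i
    change (-1 : ℂ) ^ i * ((-1) ^ i * f i) = f i
    rw [← mul_assoc, ← mul_pow]
    simp
  right_inv f := by
    ext i
    change (-1 : ℂ) ^ i * ((-1) ^ i * f i) = f i
    rw [← mul_assoc, ← mul_pow]
    simp
  norm_map' f := by
    refine (sq_eq_sq₀ (norm_nonneg _) (norm_nonneg _)).1 ?_
    refine (hasSum_norm_sq _).unique ?_
    have h (i : ℕ) : ‖(-1 : ℂ) ^ i * f i‖ ^ 2 = ‖f i‖ ^ 2 := by simp
    exact (funext h : (fun i => ‖(-1 : ℂ) ^ i * f i‖ ^ 2) = _) ▸ hasSum_norm_sq f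

theorem alternate_apply (f : H) (i : ℕ) : alternate f i = (-1) ^ i * f i := rfl

theorem pot_neg (n : ℕ) (v : ℕ → ℝ) (i : ℕ) : pot n (-v) i = -pot n v i := by
  by_cases h : i < n <;> simp [pot, h]

theorem diagOp_neg (n : ℕ) (v : ℕ → ℝ) : diagOp n (-v) = -diagOp n v := by
  simp [diagOp]

theorem alternate_conj (n : ℕ) (v : ℕ → ℝ) (f : H) :
    (J + diagOp n (-v)) (alternate f) = alternate ((((4 : ℝ) : ℂ) • 1 - (J + diagOp n v)) f) := by
  ext i
  have h : ((((4 : ℝ) : ℂ) • 1 - (J + diagOp n v)) f : H) i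
      = ((4 : ℝ) : ℂ) * f i - matrixAct n v f i := by
    rw [← add_apply]
    rfl
  rw [alternate_apply, h, add_apply]
  cases i <;> simp only [matrixAct, pot_neg, alternate_apply, pow_succ] <;> push_cast <;> ring

/-- Reflecting the spectrum at `2` and gauging away the sign of the hopping terms replaces `v` by
`-v` and the threshold `4` by `0`. -/
theorem countAbove_eq (n : ℕ) (v : ℕ → ℝ) :
    countAbove (diagOp n v) = countBelow (diagOp n (-v)) := by
  have h := isNegativeSplit_spectralSubspace_Ioi (isSelfAdjoint_add n v) 4
  obtain ⟨hfin, hd⟩ := (h.map alternate (alternate_conj n v)).isNegIndex (N := n - 2) (by omega)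
  obtain ⟨d, hd1, hd2⟩ := exists_countBelow_eq n (-v)
  have hrank := LinearEquiv.finrank_map_eq alternate.toLinearEquiv
    (spectralSubspace (J + diagOp n v) (Set.Ioi 4))
  have : FiniteDimensional ℂ (spectralSubspace (J + diagOp n v) (Set.Ioi 4)) :=
    Module.Finite.equiv
      (alternate.toLinearEquiv.submoduleMap (spectralSubspace (J + diagOp n v) (Set.Ioi 4))).symm
  rw [hd1, hd2.unique hd]
  exact (trace_starProjection _).trans (congrArg _ hrank.symm)

theorem isCriticalRight_iff (n : ℕ) (v : ℕ → ℝ) :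
    IsCriticalRight n v ↔ IsCriticalLeft n (-v) := by
  have hmaps : Set.MapsTo (fun W : H →L[ℂ] H => -W) (potentials n) (potentials n) := by
    rintro _ ⟨w, rfl⟩
    exact ⟨-w, diagOp_neg n w⟩
  have hneg : Continuous fun W : H →L[ℂ] H => -W := continuous_neg
  refine not_congr ⟨fun h => ?_, fun h => ?_⟩
  · rw [← neg_neg (diagOp n v), ← diagOp_neg] at h
    refine (h.comp (hneg.continuousWithinAt (s := potentials n)) hmaps).congr ?_ ?_
    · rintro _ ⟨w, rfl⟩
      rw [Function.comp_apply, ← diagOp_neg, countAbove_eq, neg_neg]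
    · rw [Function.comp_apply, ← diagOp_neg, countAbove_eq, neg_neg]
  · rw [diagOp_neg] at h
    refine (h.comp (hneg.continuousWithinAt (s := potentials n)) hmaps).congr ?_ ?_
    · rintro _ ⟨w, rfl⟩
      rw [Function.comp_apply, ← diagOp_neg, countAbove_eq]
    · rw [Function.comp_apply, ← diagOp_neg, countAbove_eq]

/-! ### The Jost solution -/

/-- A solution of the equation far to the right is determined by its asymptotics: the component of
a free solution along `Θ ^ (-k)` must vanish. -/
theorem eq_zero_of_free_recurrence {Θ : ℂ} (h0 : Θ ≠ 0) (h1 : ‖Θ‖ < 1) {f : ℕ → ℂ}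
    (hf : ∀ i, f i + f (i + 2) = (Θ + Θ⁻¹) * f (i + 1))
    (hlim : Tendsto (fun k => (Θ ^ k)⁻¹ * f k) atTop (𝓝 0)) (i : ℕ) : f i = 0 := by
  -- Since `Θ` and `Θ⁻¹` are the characteristic roots, two first differences are geometric. The
  -- decay of `Θ⁻ᵏ f k` forces both of them to vanish.
  have hg (k : ℕ) : f (k + 1) - Θ * f k = (Θ ^ k)⁻¹ * (f 1 - Θ * f 0) := by
    induction k with
    | zero => simp
    | succ k ih =>
      have : f (k + 2) - Θ * f (k + 1) = Θ⁻¹ * (f (k + 1) - Θ * f k) := by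
        have := hf k
        field_simp at this ⊢
        linear_combination this
      rw [this, ih, pow_succ]
      field_simp
  have hh (k : ℕ) : f (k + 1) - Θ⁻¹ * f k = Θ ^ k * (f 1 - Θ⁻¹ * f 0) := by
    induction k with
    | zero => simp
    | succ k ih =>
      have : f (k + 2) - Θ⁻¹ * f (k + 1) = Θ * (f (k + 1) - Θ⁻¹ * f k) := by
        have := hf k
        field_simp at this ⊢
        linear_combination this
      rw [this, ih, pow_succ]
      ring
  have hlim1 : Tendsto (fun k => (Θ ^ (k + 1))⁻¹ * f (k + 1)) atTop (𝓝 0) :=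
    hlim.comp (tendsto_add_atTop_nat 1)
  have hA : f 1 - Θ * f 0 = 0 := by
    have hpow : Tendsto (fun k => Θ ^ (2 * k)) atTop (𝓝 0) := by
      have h2 : ‖Θ ^ 2‖ < 1 := by
        rw [norm_pow]
        exact pow_lt_one₀ (norm_nonneg _) h1 two_ne_zero
      simpa [pow_mul] using tendsto_pow_atTop_nhds_zero_of_norm_lt_one h2
    have h3 := hpow.mul ((hlim1.const_mul Θ).sub (hlim.const_mul Θ))
    simp only [mul_zero, sub_zero] at h3
    refine tendsto_nhds_unique (tendsto_const_nhds.congr fun k => ?_) h3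
    have := hg k
    rw [two_mul, pow_add, pow_succ]
    field_simp at this ⊢
    linear_combination -this
  have hB : f 1 - Θ⁻¹ * f 0 = 0 := by
    have h3 := (hlim1.const_mul Θ).sub (hlim.const_mul Θ⁻¹)
    simp only [mul_zero, sub_zero] at h3
    refine tendsto_nhds_unique (tendsto_const_nhds.congr fun k => ?_) h3
    have := hh k
    rw [pow_succ]
    field_simp at this ⊢
    linear_combination -this
  have h2 : Θ ^ 2 ≠ 1 := by
    intro h
    have : ‖Θ‖ ^ 2 = 1 := by rw [← norm_pow, h, norm_one]
    have := pow_lt_one₀ (norm_nonneg Θ) h1 two_ne_zero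
    linarith
  have := (hg i).symm.trans (by ring : _ = (f (i + 1) - Θ⁻¹ * f i) + (Θ⁻¹ - Θ) * f i)
  rw [hh, hA, hB, mul_zero, mul_zero, zero_add] at this
  refine (mul_eq_zero.1 this.symm).resolve_left fun h => h2 ?_
  field_simp at h
  linear_combination -h

theorem IsJostSolution.unique {n : ℕ} {v : ℕ → ℝ} {Θ : ℂ} (h0 : Θ ≠ 0) (h1 : ‖Θ‖ < 1)
    {f g : ℕ → ℂ} (hf : IsJostSolution n v Θ f) (hg : IsJostSolution n v Θ g) (k : ℕ) :
    f k = g k := by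
  set d : ℕ → ℂ := fun k => f k - g k with hd
  have hrec (i : ℕ) : a i * d i + (pot n v i + Θ + Θ⁻¹) * d (i + 1) + a (i + 1) * d (i + 2)
      = 0 := by
    simp only [hd]
    linear_combination hf.1 i - hg.1 i
  have hlim : Tendsto (fun k => (Θ ^ k)⁻¹ * d k) atTop (𝓝 0) := by
    have := hf.2.sub hg.2
    rw [sub_self] at this
    refine this.congr fun k => ?_
    simp only [hd]
    ring
  have hfar (i : ℕ) : d (n + 2 + i) = 0 := by
    refine eq_zero_of_free_recurrence h0 h1 (f := fun i => d (n + 2 + i)) (fun i => ?_) ?_ i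
    · have h := hrec (n + 2 + i)
      have hp : pot n v (n + 2 + i) = 0 := if_neg (by omega)
      have ha : a (n + 2 + i) = -1 := by
        rw [show n + 2 + i = (n + i) + 2 by omega]
        rfl
      have ha' : a (n + 2 + i + 1) = -1 := by
        rw [show n + 2 + i + 1 = (n + i + 1) + 2 by omega]
        rfl
      rw [hp, ha, ha'] at h
      push_cast at h
      simp only [← add_assoc]
      linear_combination -h
    · have h := (hlim.comp (tendsto_add_atTop_nat (n + 2))).const_mul (Θ ^ (n + 2))
      rw [mul_zero] at h
      refine h.congr fun k => ?_
      simp only [Function.comp_apply]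
      rw [add_comm k, pow_add _ (n + 2), mul_inv, ← mul_assoc, ← mul_assoc,
        mul_inv_cancel₀ (pow_ne_zero _ h0), one_mul]
  suffices d k = 0 from sub_eq_zero.1 this
  have hback (M : ℕ) : (∀ i, M ≤ i → d i = 0) → d k = 0 := by
    induction M with
    | zero => exact fun h => h k k.zero_le
    | succ M ih =>
      refine fun h => ih fun i hi => ?_
      rcases hi.eq_or_lt with rfl | hi
      · have := hrec M
        rw [h (M + 1) le_rfl, h (M + 2) (by omega), mul_zero, mul_zero, add_zero, add_zero] at this
        exact (mul_eq_zero.1 this).resolve_left (by exact_mod_cast a_ne_zero M)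
      · exact h i hi
  refine hback (n + 2) fun i hi => ?_
  obtain ⟨m, rfl⟩ := Nat.exists_eq_add_of_le hi
  exact hfar m

theorem jostAux_of_le {n k : ℕ} (v : ℕ → ℝ) (hk : max 2 n ≤ k) : jostAux n v k = 1 := by
  rw [jostAux, if_pos hk]

theorem jostAux_recurrence (n : ℕ) (v : ℕ → ℝ) {Θ : ℂ} (h0 : Θ ≠ 0) (i : ℕ) :
    a i * (Θ ^ i * (jostAux n v i).eval Θ)
      + (2 + pot n v i) * (Θ ^ (i + 1) * (jostAux n v (i + 1)).eval Θ)
      + a (i + 1) * (Θ ^ (i + 2) * (jostAux n v (i + 2)).eval Θ)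
      = (2 - Θ - Θ⁻¹) * (Θ ^ (i + 1) * (jostAux n v (i + 1)).eval Θ) := by
  have ha : (a i : ℂ) ≠ 0 := by exact_mod_cast a_ne_zero i
  by_cases hi : max 2 n ≤ i
  · rw [jostAux_of_le v hi, jostAux_of_le v (by omega : max 2 n ≤ i + 1),
      jostAux_of_le v (by omega : max 2 n ≤ i + 2)]
    obtain ⟨m, rfl⟩ : ∃ m, i = m + 2 := ⟨i - 2, by omega⟩
    have hp : pot n v (m + 2) = 0 := if_neg (by omega)
    rw [hp]
    simp [a]
    field_simp
    ring
  · have hr := jostAux.eq_1 n v i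
    rw [if_neg hi] at hr
    rw [hr]
    simp only [eval_mul, eval_add, eval_pow, eval_X, eval_C, eval_one]
    field_simp
    ring

theorem isJostSolution_jostAux (n : ℕ) (v : ℕ → ℝ) {Θ : ℂ} (h0 : Θ ≠ 0) :
    IsJostSolution n v Θ fun k => Θ ^ k * (jostAux n v k).eval Θ := by
  refine ⟨jostAux_recurrence n v h0, tendsto_const_nhds.congr' ?_⟩
  filter_upwards [eventually_ge_atTop (max 2 n)] with k hk
  simp [jostAux_of_le v hk, h0]

/-- The Jost solution, at every `Θ`, is given by the auxiliary polynomials: both sides are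
polynomials that agree for `0 < |Θ| < 1`. -/
theorem jost_eq (n : ℕ) (v : ℕ → ℝ) (Θ : ℂ) (k : ℕ) :
    jost n v Θ k = Θ ^ k * (jostAux n v k).eval Θ := by
  have hj := (exists_isJostFamily n v).choose_spec
  set j := (exists_isJostFamily n v).choose with hjdef
  have hpoly : j k = X ^ k * jostAux n v k := by
    refine Polynomial.eq_of_infinite_eval_eq _ _ (Set.Infinite.mono (s := {Θ | Θ ≠ 0 ∧ ‖Θ‖ < 1})
      (fun Θ h => ?_) ?_)
    · simpa using (hj Θ h.1 h.2).unique h.1 h.2 (isJostSolution_jostAux n v h.1) k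
    · refine infinite_of_mem_nhds (1 / 2 : ℂ) ?_
      refine IsOpen.mem_nhds ?_ ?_
      · exact isOpen_ne.inter (isOpen_lt continuous_norm continuous_const)
      · norm_num
  rw [jost, ← hjdef, hpoly]
  simp

theorem jost_recurrence (n : ℕ) (v : ℕ → ℝ) {Θ : ℂ} (h0 : Θ ≠ 0) (i : ℕ) :
    a i * jost n v Θ i + (2 + pot n v i) * jost n v Θ (i + 1) + a (i + 1) * jost n v Θ (i + 2)
      = (2 - Θ - Θ⁻¹) * jost n v Θ (i + 1) := by
  simp only [jost_eq]
  exact jostAux_recurrence n v h0 i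

theorem jost_of_le {n k : ℕ} (v : ℕ → ℝ) (Θ : ℂ) (hk : max 2 n ≤ k) : jost n v Θ k = Θ ^ k := by
  rw [jost_eq, jostAux_of_le v hk]
  simp

theorem jostFunction_neg_one (n : ℕ) (v : ℕ → ℝ) :
    jostFunction n v (-1) = jostFunction n (-v) 1 := by
  have h (d : ℕ) : ∀ k, max 2 n ≤ k + d →
      (jostAux n v k).eval (-1) = (jostAux n (-v) k).eval 1 := by
    induction d using Nat.strong_induction_on with
    | _ d ih =>
      intro k hk
      by_cases hk' : max 2 n ≤ k
      · rw [jostAux_of_le v hk', jostAux_of_le (-v) hk']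
        simp
      · have h1 := ih (d - 1) (by omega) (k + 1) (by omega)
        have h2 := ih (d - 2) (by omega) (k + 2) (by omega)
        rw [jostAux.eq_1 n v, jostAux.eq_1 n (-v), if_neg hk', if_neg hk']
        simp only [eval_mul, eval_add, eval_pow, eval_X, eval_C, eval_one, h1, h2, pot_neg]
        push_cast
        ring
  simp only [jostFunction, jost_eq, pow_zero, one_mul]
  exact h _ 0 (Nat.le_add_left _ _)

/-- If `j_0(Θ) = 0`, the first row of the matrix equation no longer sees the zeroth component, so
the Jost solution is a solution on the half-line. For `|Θ| = 1` its modulus is `1` far out. -/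
theorem isVirtualState_jost {n : ℕ} {v : ℕ → ℝ} {Θ : ℂ} {lam : ℝ} (hΘ : ‖Θ‖ = 1)
    (hlam : (lam : ℂ) = 2 - Θ - Θ⁻¹) (h : jostFunction n v Θ = 0) :
    IsVirtualState n v lam fun i => jost n v Θ (i + 1) := by
  have h0 : Θ ≠ 0 := by
    rintro rfl
    simp at hΘ
  have hfar (i : ℕ) (hi : max 2 n ≤ i) : ‖jost n v Θ (i + 1)‖ = 1 := by
    rw [jost_of_le v Θ (by omega), norm_pow, hΘ, one_pow]
  refine ⟨fun i => ?_, ?_, fun hmem => ?_⟩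
  · rw [hlam]
    cases i with
    | zero =>
      have := jost_recurrence n v h0 0
      rw [← jostFunction, h, mul_zero, zero_add] at this
      exact this
    | succ i => exact jost_recurrence n v h0 (i + 1)
  · refine ⟨1 + ∑ i ∈ Finset.range (max 2 n), ‖jost n v Θ (i + 1)‖, fun i => ?_⟩
    by_cases hi : max 2 n ≤ i
    · rw [hfar i hi]
      exact le_add_of_nonneg_right (Finset.sum_nonneg fun _ _ => norm_nonneg _)
    · have := Finset.single_le_sum (f := fun i => ‖jost n v Θ (i + 1)‖)
        (fun _ _ => norm_nonneg _) (Finset.mem_range.2 (not_le.1 hi))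
      exact this.trans (le_add_of_nonneg_left zero_le_one)
  · have hs := (memℓp_gen_iff (by norm_num)).1 hmem
    have h1 : (1 : ℝ) = 0 := by
      refine tendsto_nhds_unique (tendsto_const_nhds.congr' ?_) hs.tendsto_atTop_zero
      filter_upwards [eventually_ge_atTop (max 2 n)] with i hi
      simp [hfar i hi]
    exact one_ne_zero h1

/-! ### Criticality -/

/-- The threshold matrix is degenerate exactly when the Jost function vanishes at `Θ = 1`: a null
vector is a multiple of the Jost solution, and the first row then reads `a_0 j_0(1) = 0`. -/
theorem thresholdMatrix_injective_iff (n : ℕ) (v : ℕ → ℝ) :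
    Function.Injective (thresholdMatrix n v (n - 2)) ↔ jostFunction n v 1 ≠ 0 := by
  constructor
  · intro hinj hj
    have hst := (isVirtualState_jost (v := v) (lam := 0) (Θ := 1) (by simp) (by norm_num) hj).1
    set x : EuclideanSpace ℂ (Fin (n - 2 + 2)) := WithLp.toLp 2 fun i => jost n v 1 (i + 1)
    have hext : extend (n - 2) x = fun i => jost n v 1 (i + 1) := by
      funext i
      by_cases hi : i < n - 2 + 2
      · exact extend_val x ⟨i, hi⟩
      · rw [extend_of_le (by omega)]
        change jost n v 1 (n - 2 + 1 + 1) = _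
        rw [jost_of_le v 1 (by omega), jost_of_le v 1 (by omega), one_pow, one_pow]
    have hx : thresholdMatrix n v (n - 2) x = 0 := by
      ext i
      change matrixAct n v (extend (n - 2) x) i = 0
      rw [hext, hst i]
      simp
    have hx0 : x = 0 := hinj (hx.trans (map_zero _).symm)
    have h1 : x (Fin.last _) = 1 := by
      change jost n v 1 (n - 2 + 1 + 1) = 1
      rw [jost_of_le v 1 (by omega), one_pow]
    rw [hx0] at h1
    simp at h1
  · intro hj
    refine (injective_iff_map_eq_zero _).2 fun x hx => ?_
    have hψ := matrixAct_extend_eq_zero (by omega) hx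
    set y := x (Fin.last _) with hy
    have hrec (i : ℕ) := jost_recurrence n v (one_ne_zero (α := ℂ)) i
    have hprop (i : ℕ) : extend (n - 2) x i - y * jost n v 1 (i + 1) = 0 := by
      refine eq_zero_of_recurrence (b := fun i => 2 + pot n v (i + 1))
        (ψ := fun i => extend (n - 2) x i - y * jost n v 1 (i + 1)) (M := n - 2 + 1)
        (fun i => ?_) (fun i hi => ?_) i
      · have h1 := hψ (i + 1)
        have h2 := hrec (i + 1)
        simp only [matrixAct] at h1
        rw [inv_one] at h2
        linear_combination h1 - y * h2
      · rw [extend_of_le hi, jost_of_le v 1 (by omega), one_pow, mul_one, sub_self]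
    have hy0 : y = 0 := by
      have h1 := hψ 0
      have h2 := hrec 0
      simp only [matrixAct] at h1
      rw [inv_one] at h2
      have h3 : y * (a 0 * jostFunction n v 1) = 0 := by
        rw [jostFunction]
        linear_combination y * h2 - h1 + (2 + pot n v 0) * hprop 0 + a 1 * hprop 1
      refine (mul_eq_zero.1 h3).resolve_right (mul_ne_zero ?_ hj)
      exact_mod_cast a_ne_zero 0
    ext i
    have := hprop i
    rw [hy0, zero_mul, sub_zero, extend_val] at this
    exact this

theorem energy_sub (n : ℕ) (v w : ℕ → ℝ) (N : ℕ) (ψ : ℕ → ℂ) :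
    energy n w N ψ - energy n v N ψ
      = ∑ i ∈ Finset.range (N + 2), (pot n w i - pot n v i) * ‖ψ i‖ ^ 2 := by
  simp only [energy, sub_mul, Finset.sum_sub_distrib]
  ring

theorem norm_sq_eq_sum_extend (N : ℕ) (x : EuclideanSpace ℂ (Fin (N + 2))) :
    ‖x‖ ^ 2 = ∑ i ∈ Finset.range (N + 2), ‖extend N x i‖ ^ 2 := by
  rw [EuclideanSpace.norm_sq_eq, ← Fin.sum_univ_eq_sum_range (fun i => ‖extend N x i‖ ^ 2)]
  simp only [extend_val]

theorem abs_pot_sub_le (n : ℕ) (v w : ℕ → ℝ) (i : ℕ) :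
    |pot n w i - pot n v i| ≤ ‖diagOp n w - diagOp n v‖ := by
  have h1 : ((diagOp n w - diagOp n v) (e i) : H) i = ((pot n w i - pot n v i : ℝ) : ℂ) := by
    have h2 : ((diagOp n w - diagOp n v) (e i) : H) i
        = (diagOp n w (e i) : H) i - (diagOp n v (e i) : H) i := rfl
    rw [h2, diagOp_apply, diagOp_apply]
    simp [e, lp.single_apply]
  have h3 := lp.norm_apply_le_norm (p := 2) (by norm_num) ((diagOp n w - diagOp n v) (e i)) i
  rw [h1, Complex.norm_real, Real.norm_eq_abs] at h3
  refine h3.trans ((ContinuousLinearMap.le_opNorm _ _).trans ?_)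
  simp [e, lp.norm_single]

/-- Without a null vector of the threshold matrix the number of negative eigenvalues is locally
constant. -/
theorem not_isCriticalLeft {n : ℕ} {v : ℕ → ℝ}
    (h : Function.Injective (thresholdMatrix n v (n - 2))) : ¬ IsCriticalLeft n v := by
  obtain ⟨d, hd, hind⟩ := exists_countBelow_eq n v
  obtain ⟨δ, hδ, hstab⟩ := hind.stable (thresholdMatrix_isSymmetric n v _) h
  refine not_not.2 (ContinuousWithinAt.congr_of_eventuallyEq
    (f := fun _ => countBelow (diagOp n v)) continuousWithinAt_const ?_ rfl)
  filter_upwards [self_mem_nhdsWithin, mem_nhdsWithin_of_mem_nhds (Metric.ball_mem_nhds _ hδ)]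
  rintro _ ⟨w, rfl⟩ hw
  obtain ⟨d', hd', hind'⟩ := exists_countBelow_eq n w
  rw [hd', hd, hind'.unique (hstab _ fun x => ?_)]
  rw [inner_thresholdMatrix_re, inner_thresholdMatrix_re, energy_sub, norm_sq_eq_sum_extend,
    Finset.mul_sum]
  refine (Finset.abs_sum_le_sum_abs _ _).trans (Finset.sum_le_sum fun i _ => ?_)
  rw [abs_mul, abs_of_nonneg (sq_nonneg ‖extend (n - 2) x i‖)]
  refine mul_le_mul_of_nonneg_right ((abs_pot_sub_le n v w i).trans ?_) (sq_nonneg _)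
  exact (mem_ball_iff_norm.1 hw).le

/-- Lowering the potential uniformly by an arbitrarily small amount turns a null vector of the
threshold matrix into an additional negative eigenvalue. -/
theorem isCriticalLeft_of_not_injective {n : ℕ} (hn : 1 ≤ n) {v : ℕ → ℝ}
    (h : ¬ Function.Injective (thresholdMatrix n v (n - 2))) : IsCriticalLeft n v := by
  obtain ⟨x, hx, hx0⟩ : ∃ x, thresholdMatrix n v (n - 2) x = 0 ∧ x ≠ 0 := by
    by_contra! h'
    exact h ((injective_iff_map_eq_zero _).2 h')
  have hfirst : extend (n - 2) x 0 ≠ 0 := by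
    intro h0
    refine hx0 (PiLp.ext fun i => ?_)
    rw [← extend_val]
    exact eq_zero_of_matrixAct_eq_zero (matrixAct_extend_eq_zero (by omega) hx) h0 i
  obtain ⟨d, hd, hind⟩ := exists_countBelow_eq n v
  have hjump (ε : ℝ) (hε : 0 < ε) : (d : ℝ≥0∞) + 1 ≤ countBelow (diagOp n fun i => v i - ε) := by
    obtain ⟨d', hd', hind'⟩ := exists_countBelow_eq n fun i => v i - ε
    have hpot (i : ℕ) : pot n (fun i => v i - ε) i - pot n v i = if i < n then -ε else 0 := by
      by_cases hi : i < n <;> simp [pot, hi]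
    have hterm (y : EuclideanSpace ℂ (Fin (n - 2 + 2))) (i : ℕ) :
        (pot n (fun i => v i - ε) i - pot n v i) * ‖extend (n - 2) y i‖ ^ 2 ≤ 0 := by
      refine mul_nonpos_of_nonpos_of_nonneg ?_ (sq_nonneg _)
      rw [hpot]
      split_ifs <;> linarith
    have hlt : d < d' := by
      refine hind.lt_of_kernel (thresholdMatrix_isSymmetric n v _) hind' (fun y => ?_) hx ?_
      · rw [inner_thresholdMatrix_re, inner_thresholdMatrix_re, ← sub_nonpos, energy_sub]
        exact Finset.sum_nonpos fun i _ => hterm y i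
      · have h0 : energy n v (n - 2) (extend (n - 2) x) = 0 := by
          rw [← inner_thresholdMatrix_re, hx]
          simp
        have h1 := energy_sub n v (fun i => v i - ε) (n - 2) (extend (n - 2) x)
        rw [h0, sub_zero] at h1
        rw [inner_thresholdMatrix_re, h1]
        refine Finset.sum_neg' (fun i _ => hterm x i) ⟨0, Finset.mem_range.2 (Nat.succ_pos _), ?_⟩
        rw [hpot 0, if_pos (Nat.lt_of_succ_le hn)]
        exact mul_neg_of_neg_of_pos (by linarith) (by positivity)
    rw [hd']
    exact_mod_cast hlt
  intro hcont
  have hpath : Tendsto (fun ε : ℝ => diagOp n fun i => v i - ε) (𝓝[>] 0)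
      (𝓝[potentials n] (diagOp n v)) := by
    refine tendsto_nhdsWithin_iff.2 ⟨?_, Eventually.of_forall fun ε => ⟨_, rfl⟩⟩
    have hc : Continuous fun ε : ℝ => diagOp n fun i => v i - ε := by
      unfold diagOp
      fun_prop
    have := (hc.tendsto 0).mono_left (nhdsWithin_le_nhds (s := Set.Ioi 0))
    simpa using this
  have hlim := hcont.tendsto.comp hpath
  have hle : (d : ℝ≥0∞) + 1 ≤ countBelow (diagOp n v) := by
    refine ge_of_tendsto hlim ?_
    filter_upwards [self_mem_nhdsWithin] with ε hε using hjump ε hε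
  rw [hd] at hle
  have : d + 1 ≤ d := by exact_mod_cast hle
  omega

theorem isCriticalLeft_iff {n : ℕ} (hn : 1 ≤ n) (v : ℕ → ℝ) :
    IsCriticalLeft n v ↔ jostFunction n v 1 = 0 := by
  have h := thresholdMatrix_injective_iff n v
  refine ⟨fun hc => ?_, fun hj => isCriticalLeft_of_not_injective hn fun hi => h.1 hi hj⟩
  by_contra hj
  exact not_isCriticalLeft (h.2 hj) hc

end HalfLine

theorem mainTheorem7 (n : ℕ) (hn : 1 ≤ n) (v : ℕ → ℝ) :
    (HalfLine.IsCriticalLeft n v ↔ HalfLine.jostFunction n v 1 = 0) ∧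
    (HalfLine.IsCriticalRight n v ↔ HalfLine.jostFunction n v (-1) = 0) ∧
    (HalfLine.IsCriticalLeft n v →
      HalfLine.IsVirtualLevel n v 0 ∧
      HalfLine.IsVirtualState n v 0 (fun i => HalfLine.jost n v 1 (i + 1)) ∧
      ∀ k, max 2 n ≤ k → HalfLine.jost n v 1 k = 1) ∧
    (HalfLine.IsCriticalRight n v →
      HalfLine.IsVirtualLevel n v 4 ∧
      HalfLine.IsVirtualState n v 4 (fun i => HalfLine.jost n v (-1) (i + 1)) ∧
      ∀ k, max 2 n ≤ k → HalfLine.jost n v (-1) k = (-1) ^ k) := by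
  have hleft := HalfLine.isCriticalLeft_iff hn v
  have hright : HalfLine.IsCriticalRight n v ↔ HalfLine.jostFunction n v (-1) = 0 := by
    rw [HalfLine.isCriticalRight_iff, HalfLine.isCriticalLeft_iff hn,
      HalfLine.jostFunction_neg_one]
  refine ⟨hleft, hright, fun hc => ?_, fun hc => ?_⟩
  · have hst := HalfLine.isVirtualState_jost (lam := 0) (Θ := 1) (by simp) (by norm_num)
      (hleft.1 hc)
    refine ⟨⟨_, hst⟩, hst, fun k hk => ?_⟩
    rw [HalfLine.jost_of_le v 1 hk, one_pow]
  · have hst := HalfLine.isVirtualState_jost (lam := 4) (Θ := -1) (by simp) (by norm_num)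
      (hright.1 hc)
    exact ⟨⟨_, hst⟩, hst, fun k hk => HalfLine.jost_of_le v (-1) hk⟩
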